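/- **Setting.** Let $n,d$ be dimensions, and let $\mathcal K_{bcs}(\mathbb R^d)$ be the collection of nonempty, closed, bounded, convex sets $K\subset\mathbb R^d$ that are symmetric ($-K=K$). For $K\subset\mathbb R^d$ put $|K|=\sup_{v\in K}|v|$. A set-valued map $F$ on $\mathbb R^n$ is measurable if $\{x: F(x)\cap U\neq\emptyset\}$ is Lebesgue measurable for every open $U\subset\mathbb R^d$, and locally integrably bounded if it is measurable and, for some non-negative $k\in L^1_{loc}(\mathbb R^n)$, $F(x)\subset B(0,k(x))$ for a.e. $x$. For $0<p\le\infty$, $L^p_{\mathcal K}(\mathbb R^n,|\cdot|)$ is the set of measurable maps $F$ with values in $\mathcal K_{bcs}(\mathbb R^d)$ almost everywhere such that $\|F\|_{L^p_{\mathcal K}}:=\big\|\,|F(\cdot)|\,\big\|_{L^p(\mathbb R^n)}<\infty$; for $0<p<\infty$, $L^{p,\infty}_{\mathcal K}(\mathbb R^n,|\cdot|)$ is defined in the same way with $\|F\|_{L^{p,\infty}_{\mathcal K}}:=\sup_{\lambda>0}\lambda\,|\{x:|F(x)|>\lambda\}|^{1/p}<\infty$. The Aumann integral is $$\int_Q F\,dy=\Big\{\int_Q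 f\,dy : f\in L^1(Q,\mathbb R^d),\ f(y)\in F(y)\text{ for a.e. }y\in Q\Big\}.$$ For $0<\alpha<1$ and locally integrably bounded $F$, the fractional maximal operator is $$M_\alpha F(x)=\overline{\mathrm{conv}}\Big(\bigcup_Q \chi_Q(x)\,\frac{1}{|Q|^{1-\alpha}}\int_Q F(y)\,dy\Big),$$ the union being over all cubes $Q\subset\mathbb R^n$ (of positive side length) with sides parallel to the coordinate axes. **Theorem.** Let $0<\alpha<1$. (1) If $1<p<q\le\infty$ and $1/p-1/q=\alpha$, then $M_\alpha$ is bounded from $L^p_{\mathcal K}(\mathbb R^n,|\cdot|)$ to $L^q_{\mathcal K}(\mathbb R^n,|\cdot|)$: there is a constant $C<\infty$ such that every $F\in L^p_{\mathcal K}(\mathbb R^n,|\cdot|)$ is locally integrably bounded, $M_\alpha F\in L^q_{\mathcal K}(\mathbb R^n,|\cdot|)$, and $\|M_\alpha F\|_{L^q_{\mathcal K}}\le C\|F\|_{L^p_{\mathcal K}}$. (2) $M_\alpha$ is bounded from $L^1_{\mathcal K}(\mathbb R^n,|\cdot|)$ to $L^{1/(1-\alpha),\infty}_{\mathcal K}(\mathbb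 R^n,|\cdot|)$: there is a constant $C<\infty$ such that every $F\in L^1_{\mathcal K}(\mathbb R^n,|\cdot|)$ is locally integrably bounded, $M_\alpha F\in L^{1/(1-\alpha),\infty}_{\mathcal K}(\mathbb R^n,|\cdot|)$, and $\|M_\alpha F\|_{L^{1/(1-\alpha),\infty}_{\mathcal K}}\le C\|F\|_{L^1_{\mathcal K}}$. -/

import Mathlib

open MeasureTheory Set
open scoped ENNReal NNReal Pointwise

noncomputable section

namespace ConvexSetValued

/-- The class `𝒦_bcs(ℝ^d)` of nonempty, closed, bounded, convex, symmetric subsets of `ℝ^d`. -/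
structure IsKbcs {d : ℕ} (K : Set (EuclideanSpace ℝ (Fin d))) : Prop where
  nonempty : K.Nonempty
  isClosed : IsClosed K
  isBounded : Bornology.IsBounded K
  convex : Convex ℝ K
  symmetric : -K = K

/-- `|K| = sup_{v ∈ K} |v|`, as an extended nonnegative number. -/
def setNorm {d : ℕ} (K : Set (EuclideanSpace ℝ (Fin d))) : ℝ≥0∞ :=
  ⨆ v ∈ K, ‖v‖ₑ

/-- Measurability of a set-valued map on `ℝ^n` with respect to the (complete) Lebesgue
`σ`-algebra: for every open `U`, the set `{x : F x ∩ U ≠ ∅}` is Lebesgue measurable. -/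
def SetMeasurable {n d : ℕ}
    (F : EuclideanSpace ℝ (Fin n) → Set (EuclideanSpace ℝ (Fin d))) : Prop :=
  ∀ U : Set (EuclideanSpace ℝ (Fin d)), IsOpen U →
    NullMeasurableSet {x | (F x ∩ U).Nonempty} volume

/-- `F` is measurable and `F x ⊆ B(0, k x)` for a.e. `x`, for some nonnegative
`k ∈ L¹_loc(ℝ^n)`. -/
def LocallyIntegrablyBounded {n d : ℕ}
    (F : EuclideanSpace ℝ (Fin n) → Set (EuclideanSpace ℝ (Fin d))) : Prop :=
  SetMeasurable F ∧
    ∃ k : EuclideanSpace ℝ (Fin n) → ℝ, (∀ x, 0 ≤ k x) ∧ LocallyIntegrable k volume ∧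
      ∀ᵐ x, F x ⊆ Metric.ball 0 (k x)

/-- The Aumann integral of `F` over `Q`: the set of integrals over `Q` of the integrable
selections of `F` on `Q`. -/
def aumannIntegral {n d : ℕ} (Q : Set (EuclideanSpace ℝ (Fin n)))
    (F : EuclideanSpace ℝ (Fin n) → Set (EuclideanSpace ℝ (Fin d))) :
    Set (EuclideanSpace ℝ (Fin d)) :=
  {v | ∃ f : EuclideanSpace ℝ (Fin n) → EuclideanSpace ℝ (Fin d),
    IntegrableOn f Q volume ∧ (∀ᵐ x ∂(volume.restrict Q), f x ∈ F x) ∧ ∫ x in Q, f x = v}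

/-- Cubes (of positive side length) with sides parallel to the coordinate axes; as for dyadic
cubes, they are taken half-open. -/
def IsCube {n : ℕ} (Q : Set (EuclideanSpace ℝ (Fin n))) : Prop :=
  ∃ (a : EuclideanSpace ℝ (Fin n)) (l : ℝ), 0 < l ∧
    Q = {x | ∀ i, a i ≤ x i ∧ x i < a i + l}

/-- The fractional average `A_{Q,α} F(x) = χ_Q(x) |Q|^{-(1-α)} ∫_Q F`. -/
def fractionalAverage {n d : ℕ} (Q : Set (EuclideanSpace ℝ (Fin n))) (α : ℝ)
    (F : EuclideanSpace ℝ (Fin n) → Set (EuclideanSpace ℝ (Fin d)))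
    (x : EuclideanSpace ℝ (Fin n)) : Set (EuclideanSpace ℝ (Fin d)) :=
  Q.indicator (fun _ => (1 : ℝ)) x •
    ((1 / (volume.real Q) ^ (1 - α)) • aumannIntegral Q F)

/-- The fractional maximal operator: the closed convex hull of `⋃_Q A_{Q,α} F(x)`, the union
being over all cubes with sides parallel to the axes. -/
def fractionalMaximal {n d : ℕ} (α : ℝ)
    (F : EuclideanSpace ℝ (Fin n) → Set (EuclideanSpace ℝ (Fin d)))
    (x : EuclideanSpace ℝ (Fin n)) : Set (EuclideanSpace ℝ (Fin d)) :=
  closure (convexHull ℝ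
    (⋃ (Q : Set (EuclideanSpace ℝ (Fin n))) (_ : IsCube Q), fractionalAverage Q α F x))

/-- The norm of `L^p_𝒦(ℝ^n, |·|)`, the `L^p` norm of `x ↦ |F x|`
(the essential supremum for `p = ∞`). -/
def normLK {n d : ℕ} (p : ℝ≥0∞)
    (F : EuclideanSpace ℝ (Fin n) → Set (EuclideanSpace ℝ (Fin d))) : ℝ≥0∞ :=
  eLpNorm (fun x => setNorm (F x)) p volume

/-- The quasi-norm of `L^{p,∞}_𝒦(ℝ^n, |·|)`: `sup_{t > 0} t |{x : |F x| > t}|^{1/p}`. -/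
def normWeakLK {n d : ℕ} (p : ℝ)
    (F : EuclideanSpace ℝ (Fin n) → Set (EuclideanSpace ℝ (Fin d))) : ℝ≥0∞ :=
  ⨆ (t : ℝ≥0) (_ : 0 < t), (t : ℝ≥0∞) * volume {x | (t : ℝ≥0∞) < setNorm (F x)} ^ (1 / p)

/-- Membership in `L^p_𝒦(ℝ^n, |·|)`. As usual for Lebesgue spaces, the values only matter
almost everywhere. -/
structure MemLK {n d : ℕ} (p : ℝ≥0∞)
    (F : EuclideanSpace ℝ (Fin n) → Set (EuclideanSpace ℝ (Fin d))) : Prop where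
  measurable : SetMeasurable F
  values : ∀ᵐ x, IsKbcs (F x)
  norm_lt_top : normLK p F < ∞

/-- Membership in `L^{p,∞}_𝒦(ℝ^n, |·|)`. -/
structure MemWeakLK {n d : ℕ} (p : ℝ)
    (F : EuclideanSpace ℝ (Fin n) → Set (EuclideanSpace ℝ (Fin d))) : Prop where
  measurable : SetMeasurable F
  values : ∀ᵐ x, IsKbcs (F x)
  norm_lt_top : normWeakLK p F < ∞

end ConvexSetValued

end

open ConvexSetValued

/-!
If `x ∈ Q`, the fractional average of `|F|` over a cube `Q` is bounded in two ways: comparing `Q`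
with a ball, `|Q|⁻¹ ∫_Q |F| ≤ c M|F|(x)` with `M` the Hardy–Littlewood maximal function; by Hölder,
`|Q|^(1/p - 1) ∫_Q |F| ≤ ‖F‖_p`. The weighted geometric mean of these bounds with weights `1 - θ`
and `θ = pα` gives Hedberg's inequality `|M_α F| ≤ (c M|F|)^(1 - θ) ‖F‖_p^θ`, and since
`1 - θ = p / q` the strong and weak type estimates for `M_α` follow from those for `M`.

Measurability of `M_α F` comes from lower hemicontinuity: an average over `Q ∋ x`, contracted
slightly, is an average over a slightly larger cube, which contains a neighbourhood of `x`.
-/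

namespace ConvexSetValued

section LayerCake

variable {X : Type*} [MeasurableSpace X] {μ : Measure X}

theorem lintegral_Ioi_ofReal_rpow_eq_top (s : ℝ) :
    ∫⁻ t in Ioi (0 : ℝ), ENNReal.ofReal (t ^ s) = ∞ := by
  by_contra h
  refine not_integrableOn_Ioi_rpow s ⟨by fun_prop, ?_⟩
  rw [hasFiniteIntegral_iff_ofReal]
  · exact lt_top_iff_ne_top.2 h
  · filter_upwards [ae_restrict_mem measurableSet_Ioi] with t ht
    exact Real.rpow_nonneg (le_of_lt ht) s

theorem lintegral_rpow_eq_lintegral_meas_ofReal_lt_mul {g : X → ℝ≥0∞} (hg : AEMeasurable g μ)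
    {p : ℝ} (hp : 0 < p) :
    ∫⁻ x, g x ^ p ∂μ = ENNReal.ofReal p * ∫⁻ t in Ioi (0 : ℝ),
      μ {x | ENNReal.ofReal t < g x} * ENNReal.ofReal (t ^ (p - 1)) := by
  by_cases hfin : ∀ᵐ x ∂μ, g x ≠ ∞
  · have hpow : ∀ᵐ x ∂μ, g x ^ p = ENNReal.ofReal ((g x).toReal ^ p) := by
      filter_upwards [hfin] with x hx
      rw [← ENNReal.ofReal_rpow_of_nonneg ENNReal.toReal_nonneg hp.le, ENNReal.ofReal_toReal hx]
    rw [lintegral_congr_ae hpow, lintegral_rpow_eq_lintegral_meas_lt_mul μ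
      (.of_forall fun _ => ENNReal.toReal_nonneg) hg.ennreal_toReal hp]
    congr 1
    refine setLIntegral_congr_fun measurableSet_Ioi fun t ht => ?_
    congr 1
    refine measure_congr ?_
    filter_upwards [hfin] with x hx
    exact propext (ENNReal.ofReal_lt_iff_lt_toReal (le_of_lt ht) hx).symm
  · have hpos : μ {x | g x = ∞} ≠ 0 := by simpa [ae_iff] using hfin
    have hle : ∫⁻ t in Ioi (0 : ℝ), μ {x | g x = ∞} * ENNReal.ofReal (t ^ (p - 1)) ≤
        ∫⁻ t in Ioi (0 : ℝ), μ {x | ENNReal.ofReal t < g x} * ENNReal.ofReal (t ^ (p - 1)) := by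
      gcongr with t x
      intro hx
      exact hx ▸ ENNReal.ofReal_lt_top
    rw [lintegral_const_mul _ (by fun_prop), lintegral_Ioi_ofReal_rpow_eq_top,
      ENNReal.mul_top hpos, top_le_iff] at hle
    rw [hle, ENNReal.mul_top (by simpa using hp)]
    refine lintegral_eq_top_of_measure_eq_top_ne_zero (hg.pow_const p) fun h => hpos ?_
    exact measure_mono_null (fun x hx => by simp_all) h

theorem lintegral_rpow_le_of_mul_measure_lt_le {ν : Measure X} {g h : X → ℝ≥0∞}
    (hg : AEMeasurable g μ) (hh : AEMeasurable h ν) {A : ℝ≥0∞} (hA : A ≠ ∞) {p : ℝ} (hp : 1 < p)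
    (hgh : ∀ t : ℝ, 0 < t → ENNReal.ofReal t * μ {x | ENNReal.ofReal t < g x} ≤
      A * ν {x | ENNReal.ofReal t < h x}) :
    ∫⁻ x, g x ^ p ∂μ ≤
      ENNReal.ofReal p * A * (ENNReal.ofReal (p - 1))⁻¹ * ∫⁻ x, h x ^ (p - 1) ∂ν := by
  have hbound : ∀ t ∈ Ioi (0 : ℝ),
      μ {x | ENNReal.ofReal t < g x} * ENNReal.ofReal (t ^ (p - 1)) ≤
        A * (ν {x | ENNReal.ofReal t < h x} * ENNReal.ofReal (t ^ (p - 1 - 1))) := by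
    intro t (ht : 0 < t)
    have ht' : ENNReal.ofReal (t ^ (p - 1)) =
        ENNReal.ofReal t * ENNReal.ofReal (t ^ (p - 1 - 1)) := by
      rw [← ENNReal.ofReal_mul ht.le, Real.rpow_sub_one ht.ne' (p - 1), mul_div_cancel₀ _ ht.ne']
    rw [ht', ← mul_assoc, ← mul_assoc, mul_comm (μ _)]
    gcongr ?_ * _
    exact hgh t ht
  calc ∫⁻ x, g x ^ p ∂μ
      = ENNReal.ofReal p * ∫⁻ t in Ioi (0 : ℝ),
          μ {x | ENNReal.ofReal t < g x} * ENNReal.ofReal (t ^ (p - 1)) :=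
        lintegral_rpow_eq_lintegral_meas_ofReal_lt_mul hg (by linarith)
    _ ≤ ENNReal.ofReal p * ∫⁻ t in Ioi (0 : ℝ),
          A * (ν {x | ENNReal.ofReal t < h x} * ENNReal.ofReal (t ^ (p - 1 - 1))) := by
        gcongr ENNReal.ofReal p * ?_
        exact setLIntegral_mono' measurableSet_Ioi hbound
    _ = ENNReal.ofReal p * A * (ENNReal.ofReal (p - 1))⁻¹ * ∫⁻ x, h x ^ (p - 1) ∂ν := by
        rw [lintegral_const_mul' _ _ hA,
          lintegral_rpow_eq_lintegral_meas_ofReal_lt_mul hh (sub_pos.2 hp), mul_assoc, mul_assoc,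
          ENNReal.inv_mul_cancel_left (by simpa using hp) ENNReal.ofReal_ne_top]

theorem lintegral_rpow_sub_one_withDensity {f : X → ℝ≥0∞} (hf : AEMeasurable f μ) {p : ℝ}
    (hp : 1 ≤ p) : ∫⁻ x, f x ^ (p - 1) ∂(μ.withDensity f) = ∫⁻ x, f x ^ p ∂μ := by
  rw [lintegral_withDensity_eq_lintegral_mul₀ hf (hf.pow_const _)]
  congr with x
  rw [Pi.mul_apply, ← add_sub_cancel 1 p,
    ENNReal.rpow_add_of_nonneg _ _ zero_le_one (sub_nonneg.2 hp), ENNReal.rpow_one,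
    add_sub_cancel]

theorem lintegral_rpow_le_of_mul_measure_lt_le_setLIntegral {f g : X → ℝ≥0∞}
    (hf : AEMeasurable f μ) (hg : AEMeasurable g μ) {A : ℝ≥0∞} (hA : A ≠ ∞) {p : ℝ} (hp : 1 < p)
    (hgf : ∀ t : ℝ, 0 < t → ENNReal.ofReal t * μ {x | ENNReal.ofReal t < g x} ≤
      A * ∫⁻ x in {x | ENNReal.ofReal t < 2 * f x}, f x ∂μ) :
    ∫⁻ x, g x ^ p ∂μ ≤ ENNReal.ofReal p * A * (ENNReal.ofReal (p - 1))⁻¹ * 2 ^ (p - 1) *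
      ∫⁻ x, f x ^ p ∂μ := by
  have hp' : 0 ≤ p - 1 := sub_nonneg.2 hp.le
  have hf' : AEMeasurable (fun x => 2 * f x) (μ.withDensity f) :=
    (hf.const_mul 2).mono_ac (withDensity_absolutelyContinuous μ f)
  have hdist (t : ℝ) : ∫⁻ x in {x | ENNReal.ofReal t < 2 * f x}, f x ∂μ =
      μ.withDensity f {x | ENNReal.ofReal t < 2 * f x} :=
    (withDensity_apply₀ f (nullMeasurableSet_lt aemeasurable_const (hf.const_mul 2))).symm
  refine (lintegral_rpow_le_of_mul_measure_lt_le hg hf' hA hp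
    fun t ht => hdist t ▸ hgf t ht).trans_eq ?_
  simp_rw [ENNReal.mul_rpow_of_nonneg _ _ hp']
  rw [lintegral_const_mul' _ _ (ENNReal.rpow_ne_top_of_nonneg hp' ENNReal.ofNat_ne_top),
    lintegral_rpow_sub_one_withDensity hf hp.le, mul_assoc _ (2 ^ (p - 1))]

end LayerCake

section MaximalFunction

open Metric Module Filter Topology

section PseudoMetric

variable {E : Type*} [PseudoMetricSpace E] [MeasurableSpace E] (μ : Measure E)

/-- The uncentred Hardy–Littlewood maximal function over open balls. -/
noncomputable def maximalFunction (f : E → ℝ≥0∞) (x : E) : ℝ≥0∞ :=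
  ⨆ (c : E) (r : ℝ) (_ : x ∈ ball c r), ⨍⁻ y in ball c r, f y ∂μ

theorem setLAverage_ball_le_maximalFunction (f : E → ℝ≥0∞) {x c : E} {r : ℝ} (h : x ∈ ball c r) :
    ⨍⁻ y in ball c r, f y ∂μ ≤ maximalFunction μ f x :=
  le_iSup_of_le c (le_iSup₂_of_le r h le_rfl)

variable {μ}

theorem lt_maximalFunction_iff {f : E → ℝ≥0∞} {x : E} {t : ℝ≥0∞} :
    t < maximalFunction μ f x ↔ ∃ c r, x ∈ ball c r ∧ t < ⨍⁻ y in ball c r, f y ∂μ := by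
  simp only [maximalFunction, lt_iSup_iff, exists_prop]

theorem isOpen_setOf_lt_maximalFunction (f : E → ℝ≥0∞) (t : ℝ≥0∞) :
    IsOpen {x | t < maximalFunction μ f x} := by
  have : {x | t < maximalFunction μ f x} =
      ⋃ (c : E) (r : ℝ) (_ : t < ⨍⁻ y in ball c r, f y ∂μ), ball c r := by
    ext x
    simp only [lt_maximalFunction_iff, mem_ofPred_eq, mem_iUnion, exists_prop, and_comm]
  rw [this]
  exact isOpen_iUnion fun c => isOpen_iUnion fun r => isOpen_iUnion fun _ => isOpen_ball

theorem measurable_maximalFunction [OpensMeasurableSpace E] (f : E → ℝ≥0∞) :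
    Measurable (maximalFunction μ f) :=
  measurable_of_Ioi fun t => (isOpen_setOf_lt_maximalFunction f t).measurableSet

theorem maximalFunction_le_add_const {f g : E → ℝ≥0∞} {t : ℝ≥0∞} (h : ∀ x, f x ≤ g x + t)
    (x : E) : maximalFunction μ f x ≤ maximalFunction μ g x + t := by
  refine iSup_le fun c => iSup₂_le fun r hx => ?_
  calc ⨍⁻ y in ball c r, f y ∂μ
      ≤ ⨍⁻ y in ball c r, (g y + t) ∂μ := lintegral_mono h
    _ = ⨍⁻ y in ball c r, g y ∂μ + ⨍⁻ _ in ball c r, t ∂μ :=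
        lintegral_add_right _ measurable_const
    _ ≤ maximalFunction μ g x + t := by
        gcongr
        · exact setLAverage_ball_le_maximalFunction μ g hx
        · rw [laverage_eq, lintegral_const]
          exact ENNReal.div_le_of_le_mul le_rfl

end PseudoMetric

section Haar

variable {E : Type*} [NormedAddCommGroup E] [NormedSpace ℝ E] [FiniteDimensional ℝ E]
  [MeasurableSpace E] [BorelSpace E] {μ : Measure E} [μ.IsAddHaarMeasure]

theorem mul_measure_biUnion_ball_le {f : E → ℝ≥0∞} {t : ℝ≥0∞} {R : ℝ} {s : Set (E × ℝ)}
    (hs : ∀ i ∈ s, 0 < i.2 ∧ i.2 ≤ R ∧ t < ⨍⁻ y in ball i.1 i.2, f y ∂μ) :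
    t * μ (⋃ i ∈ s, ball i.1 i.2) ≤ 4 ^ finrank ℝ E * ∫⁻ y, f y ∂μ := by
  obtain ⟨u, hus, hdisj, hcov⟩ := Vitali.exists_disjoint_subfamily_covering_enlargement_ball
    s Prod.fst Prod.snd R (fun i hi => (hs i hi).2.1) 4 (by norm_num)
  have hcount : u.Countable := hdisj.countable_of_isOpen (fun _ _ => isOpen_ball)
    fun i hi => nonempty_ball.2 (hs i (hus hi)).1
  have hsub : ⋃ i ∈ s, ball i.1 i.2 ⊆ ⋃ i ∈ u, ball i.1 (4 * i.2) :=
    iUnion₂_subset fun i hi =>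
      let ⟨_, hj, hij⟩ := hcov i hi
      hij.trans (subset_iUnion₂_of_subset _ hj Subset.rfl)
  have hball : ∀ i ∈ u, t * μ (ball i.1 (4 * i.2)) ≤
      4 ^ finrank ℝ E * ∫⁻ y in ball i.1 i.2, f y ∂μ := by
    intro i hi
    obtain ⟨-, -, ht⟩ := hs i (hus hi)
    rw [Measure.addHaar_ball_mul_of_pos μ _ four_pos, ← Measure.addHaar_ball_center μ i.1,
      ← measure_mul_setLAverage f measure_ball_lt_top.ne, mul_left_comm, mul_comm t,
      ENNReal.ofReal_pow zero_le_four, ENNReal.ofReal_ofNat]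
    gcongr
  have := hcount.to_subtype
  calc t * μ (⋃ i ∈ s, ball i.1 i.2)
      ≤ t * ∑' i : u, μ (ball i.1.1 (4 * i.1.2)) := by
        gcongr
        exact (measure_mono hsub).trans (measure_biUnion_le μ hcount _)
    _ ≤ ∑' i : u, 4 ^ finrank ℝ E * ∫⁻ y in ball i.1.1 i.1.2, f y ∂μ := by
        rw [← ENNReal.tsum_mul_left]
        exact ENNReal.tsum_le_tsum fun i => hball i i.2
    _ = 4 ^ finrank ℝ E * ∫⁻ y in ⋃ i ∈ u, ball i.1 i.2, f y ∂μ := by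
        rw [ENNReal.tsum_mul_left, lintegral_biUnion hcount (fun _ _ => measurableSet_ball) hdisj]
    _ ≤ 4 ^ finrank ℝ E * ∫⁻ y, f y ∂μ := by
        gcongr
        exact Measure.restrict_le_self

theorem mul_measure_lt_maximalFunction_le (f : E → ℝ≥0∞) (t : ℝ≥0∞) :
    t * μ {x | t < maximalFunction μ f x} ≤ 4 ^ finrank ℝ E * ∫⁻ y, f y ∂μ := by
  let s (N : ℕ) : Set (E × ℝ) := {i | 0 < i.2 ∧ i.2 ≤ N ∧ t < ⨍⁻ y in ball i.1 i.2, f y ∂μ}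
  have hunion : {x | t < maximalFunction μ f x} = ⋃ N, ⋃ i ∈ s N, ball i.1 i.2 := by
    ext x
    simp only [s, lt_maximalFunction_iff, mem_ofPred_eq, mem_iUnion, exists_prop, Prod.exists]
    constructor
    · rintro ⟨c, r, hx, ht⟩
      obtain ⟨N, hN⟩ := exists_nat_ge r
      exact ⟨N, c, r, ⟨pos_of_mem_ball hx, hN, ht⟩, hx⟩
    · rintro ⟨-, c, r, ⟨-, -, ht⟩, hx⟩
      exact ⟨c, r, hx, ht⟩
  have hmono : Monotone fun N => ⋃ i ∈ s N, ball i.1 i.2 := fun N N' h =>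
    biUnion_subset_biUnion_left fun i hi => ⟨hi.1, hi.2.1.trans (Nat.cast_le.2 h), hi.2.2⟩
  rw [hunion, hmono.measure_iUnion, ENNReal.mul_iSup]
  exact iSup_le fun N => mul_measure_biUnion_ball_le fun i hi => hi

-- The part of `f` below `t / 2` adds at most `t / 2` to an average.
theorem mul_measure_lt_maximalFunction_le_setLIntegral {f : E → ℝ≥0∞} (hf : AEMeasurable f μ)
    (t : ℝ≥0∞) :
    t * μ {x | t < maximalFunction μ f x} ≤
      2 * 4 ^ finrank ℝ E * ∫⁻ x in {x | t < 2 * f x}, f x ∂μ := by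
  set g : E → ℝ≥0∞ := {x | t < 2 * f x}.indicator f
  have hfg (x : E) : f x ≤ g x + t / 2 := by
    by_cases hx : t < 2 * f x
    · exact (indicator_of_mem (s := {x | t < 2 * f x}) hx f).ge.trans le_self_add
    · rw [not_lt, mul_comm] at hx
      exact ((ENNReal.le_div_iff_mul_le (by simp) (by simp)).2 hx).trans le_add_self
  have hsub : {x | t < maximalFunction μ f x} ⊆ {x | t / 2 < maximalFunction μ g x} := by
    intro x hx
    have := (ENNReal.add_halves t).trans_lt (lt_of_lt_of_le hx (maximalFunction_le_add_const hfg x))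
    exact lt_of_add_lt_add_right this
  calc t * μ {x | t < maximalFunction μ f x}
      ≤ 2 * (t / 2 * μ {x | t / 2 < maximalFunction μ g x}) := by
        rw [← mul_assoc, ENNReal.mul_div_cancel two_ne_zero ENNReal.ofNat_ne_top]
        gcongr
    _ ≤ 2 * (4 ^ finrank ℝ E * ∫⁻ x, g x ∂μ) := by
        gcongr 2 * ?_
        exact mul_measure_lt_maximalFunction_le g _
    _ = 2 * 4 ^ finrank ℝ E * ∫⁻ x in {x | t < 2 * f x}, f x ∂μ := by
        rw [mul_assoc, lintegral_indicator₀
          (nullMeasurableSet_lt aemeasurable_const (hf.const_mul 2))]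

variable (μ) in
theorem exists_lintegral_maximalFunction_rpow_le {p : ℝ} (hp : 1 < p) :
    ∃ C : ℝ≥0∞, C ≠ ∞ ∧ ∀ f : E → ℝ≥0∞, AEMeasurable f μ →
      ∫⁻ x, maximalFunction μ f x ^ p ∂μ ≤ C * ∫⁻ x, f x ^ p ∂μ := by
  refine ⟨_, ?_, fun f hf => lintegral_rpow_le_of_mul_measure_lt_le_setLIntegral hf
    (measurable_maximalFunction f).aemeasurable (A := 2 * 4 ^ finrank ℝ E) (by finiteness) hp
    fun t _ => mul_measure_lt_maximalFunction_le_setLIntegral hf _⟩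
  have : (ENNReal.ofReal (p - 1))⁻¹ ≠ ∞ := by simpa using hp
  finiteness

end Haar

end MaximalFunction

section Cube

open Filter Topology

variable {n : ℕ} {Q : Set (EuclideanSpace ℝ (Fin n))}

/-- The half-open cube with lower corner `a` and side length `l`. -/
def cube (a : EuclideanSpace ℝ (Fin n)) (l : ℝ) : Set (EuclideanSpace ℝ (Fin n)) :=
  {x | ∀ i, a i ≤ x i ∧ x i < a i + l}

theorem isCube_iff : IsCube Q ↔ ∃ a l, 0 < l ∧ Q = cube a l := Iff.rfl

theorem isCube_cube (a : EuclideanSpace ℝ (Fin n)) {l : ℝ} (hl : 0 < l) : IsCube (cube a l) :=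
  ⟨a, l, hl, rfl⟩

theorem cube_eq_preimage (a : EuclideanSpace ℝ (Fin n)) (l : ℝ) :
    cube a l = WithLp.ofLp ⁻¹' univ.pi fun i => Ico (a i) (a i + l) := by
  ext x
  simp [cube]

theorem measurableSet_cube (a : EuclideanSpace ℝ (Fin n)) (l : ℝ) : MeasurableSet (cube a l) := by
  rw [cube_eq_preimage]
  exact (PiLp.volume_preserving_ofLp (Fin n)).measurable
    (MeasurableSet.univ_pi fun _ => measurableSet_Ico)

theorem volume_cube (a : EuclideanSpace ℝ (Fin n)) (l : ℝ) :
    volume (cube a l) = ENNReal.ofReal l ^ n := by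
  rw [cube_eq_preimage, (PiLp.volume_preserving_ofLp (Fin n)).measure_preimage
    (MeasurableSet.univ_pi fun _ => measurableSet_Ico).nullMeasurableSet, Real.volume_pi_Ico]
  simp

theorem volume_real_cube (a : EuclideanSpace ℝ (Fin n)) {l : ℝ} (hl : 0 ≤ l) :
    volume.real (cube a l) = l ^ n := by
  rw [measureReal_def, volume_cube, ENNReal.toReal_pow, ENNReal.toReal_ofReal hl]

namespace IsCube

theorem measurableSet (hQ : IsCube Q) : MeasurableSet Q := by
  obtain ⟨a, l, -, rfl⟩ := isCube_iff.1 hQ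
  exact measurableSet_cube a l

theorem volume_ne_top (hQ : IsCube Q) : volume Q ≠ ∞ := by
  obtain ⟨a, l, -, rfl⟩ := isCube_iff.1 hQ
  rw [volume_cube]
  finiteness

theorem volume_ne_zero (hQ : IsCube Q) : volume Q ≠ 0 := by
  obtain ⟨a, l, hl, rfl⟩ := isCube_iff.1 hQ
  rw [volume_cube]
  exact pow_ne_zero n (ENNReal.ofReal_pos.2 hl).ne'

theorem volume_real_pos (hQ : IsCube Q) : 0 < volume.real Q :=
  ENNReal.toReal_pos hQ.volume_ne_zero hQ.volume_ne_top

theorem exists_mem_nhdsSet (hQ : IsCube Q) {U : Set ℝ} (hU : U ∈ 𝓝 (volume.real Q)) :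
    ∃ Q', IsCube Q' ∧ Q' ∈ 𝓝ˢ Q ∧ volume.real Q' ∈ U := by
  obtain ⟨a, l, hl, rfl⟩ := isCube_iff.1 hQ
  rw [volume_real_cube a hl.le] at hU
  have hlim : Tendsto (fun ε : ℝ => (l + 2 * ε) ^ n) (𝓝[>] 0) (𝓝 (l ^ n)) := by
    have : Continuous fun ε : ℝ => (l + 2 * ε) ^ n := by fun_prop
    simpa using (this.tendsto 0).mono_left nhdsWithin_le_nhds
  obtain ⟨ε, hεU, hε : 0 < ε⟩ := ((hlim.eventually hU).and self_mem_nhdsWithin).exists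
  refine ⟨cube (WithLp.toLp 2 fun i => a i - ε) (l + 2 * ε), isCube_cube _ (by positivity),
    mem_nhdsSet_iff_forall.2 fun x hx => eventually_all.2 fun i => ?_, ?_⟩
  · have hxi : Ioo (a i - ε) (a i + l + ε) ∈ 𝓝 (x i) :=
      Ioo_mem_nhds (by linarith [(hx i).1]) (by linarith [(hx i).2])
    filter_upwards [(by fun_prop : ContinuousAt (fun y : EuclideanSpace ℝ (Fin n) => y i) x) hxi]
      with y hy
    exact ⟨hy.1.le, hy.2.trans_eq (by ring : a i + l + ε = a i - ε + (l + 2 * ε))⟩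
  · rw [volume_real_cube _ (by positivity)]
    exact hεU

end IsCube

/-- The ratio of the volumes of a ball of radius `(n + 1) l` and a cube of side length `l`; such a
ball contains every cube of side length `l` through its centre. -/
noncomputable def ballCubeRatio (n : ℕ) : ℝ≥0∞ :=
  ENNReal.ofReal ((n : ℝ) + 1) ^ n * volume (Metric.ball (0 : EuclideanSpace ℝ (Fin n)) 1)

theorem ballCubeRatio_ne_top : ballCubeRatio n ≠ ∞ :=
  ENNReal.mul_ne_top (by finiteness) measure_ball_lt_top.ne

theorem IsCube.exists_subset_ball (hQ : IsCube Q) {x : EuclideanSpace ℝ (Fin n)} (hx : x ∈ Q) :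
    ∃ r, 0 < r ∧ Q ⊆ Metric.ball x r ∧ volume (Metric.ball x r) = ballCubeRatio n * volume Q := by
  obtain ⟨a, l, hl, rfl⟩ := isCube_iff.1 hQ
  refine ⟨(n + 1) * l, by positivity, fun y hy => ?_, ?_⟩
  · have hcoord (i : Fin n) : ‖(y - x) i‖ ≤ l := by
      rw [PiLp.sub_apply, Real.norm_eq_abs, abs_le]
      constructor <;> linarith [(hx i).1, (hx i).2, (hy i).1, (hy i).2]
    rw [mem_ball_iff_norm]
    refine lt_of_pow_lt_pow_left₀ 2 (by positivity) ?_
    calc ‖y - x‖ ^ 2 = ∑ i, ‖(y - x) i‖ ^ 2 := EuclideanSpace.norm_sq_eq _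
      _ ≤ ∑ _i : Fin n, l ^ 2 := Finset.sum_le_sum fun i _ => by gcongr; exact hcoord i
      _ = n * l ^ 2 := by simp
      _ < (n + 1) ^ 2 * l ^ 2 := by
          gcongr
          nlinarith [Nat.cast_nonneg (α := ℝ) n]
      _ = ((n + 1) * l) ^ 2 := (mul_pow _ _ _).symm
  · rw [Measure.addHaar_ball_of_pos _ _ (by positivity), volume_cube, finrank_euclideanSpace_fin,
      ENNReal.ofReal_pow (by positivity), ENNReal.ofReal_mul (by positivity), mul_pow,
      ballCubeRatio, mul_right_comm]

end Cube

section Hedberg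

theorem setLIntegral_le_eLpNorm_mul_rpow {X : Type*} [MeasurableSpace X] {μ : Measure X}
    {f : X → ℝ≥0∞} (hf : AEMeasurable f μ) {p : ℝ≥0∞} (hp : 1 ≤ p) (s : Set X) :
    ∫⁻ x in s, f x ∂μ ≤ eLpNorm f p μ * μ s ^ (1 - 1 / p.toReal) := by
  have h := eLpNorm_le_eLpNorm_mul_rpow_measure_univ hp (hf.restrict (s := s)).aestronglyMeasurable
  simp only [eLpNorm_one_eq_lintegral_enorm, enorm_eq_self, Measure.restrict_apply_univ,
    ENNReal.toReal_one, div_one] at h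
  grw [h, eLpNorm_restrict_le]

variable {n : ℕ} {Q : Set (EuclideanSpace ℝ (Fin n))} {x : EuclideanSpace ℝ (Fin n)}
  {f : EuclideanSpace ℝ (Fin n) → ℝ≥0∞}

theorem IsCube.setLAverage_le (hQ : IsCube Q) (hx : x ∈ Q)
    (f : EuclideanSpace ℝ (Fin n) → ℝ≥0∞) :
    ⨍⁻ y in Q, f y ∂volume ≤ ballCubeRatio n * maximalFunction volume f x := by
  obtain ⟨r, hr, hsub, hvol⟩ := hQ.exists_subset_ball hx
  rw [setLAverage_eq, ENNReal.div_le_iff hQ.volume_ne_zero hQ.volume_ne_top]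
  calc ∫⁻ y in Q, f y
      ≤ ∫⁻ y in Metric.ball x r, f y := lintegral_mono_set hsub
    _ = volume (Metric.ball x r) * ⨍⁻ y in Metric.ball x r, f y ∂volume :=
        (measure_mul_setLAverage f measure_ball_lt_top.ne).symm
    _ ≤ ballCubeRatio n * volume Q * maximalFunction volume f x := by
        rw [hvol]
        gcongr
        exact setLAverage_ball_le_maximalFunction volume f (Metric.mem_ball_self hr)
    _ = ballCubeRatio n * maximalFunction volume f x * volume Q := mul_right_comm _ _ _

theorem IsCube.rpow_mul_setLIntegral_le (hQ : IsCube Q) (hx : x ∈ Q)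
    (hf : AEMeasurable f volume) {p : ℝ≥0∞} (hp : 1 ≤ p) {θ : ℝ} (hθ0 : 0 ≤ θ) (hθ1 : θ ≤ 1) :
    volume Q ^ (θ / p.toReal - 1) * ∫⁻ y in Q, f y ≤
      (ballCubeRatio n * maximalFunction volume f x) ^ (1 - θ) * eLpNorm f p volume ^ θ := by
  set V := volume Q
  set I := ∫⁻ y in Q, f y
  have hV0 : V ≠ 0 := hQ.volume_ne_zero
  have hVtop : V ≠ ∞ := hQ.volume_ne_top
  have hθ1' : 0 ≤ 1 - θ := sub_nonneg.2 hθ1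
  have hmax : V ^ (-1 : ℝ) * I ≤ ballCubeRatio n * maximalFunction volume f x := by
    rw [ENNReal.rpow_neg_one, mul_comm, ← div_eq_mul_inv, ← setLAverage_eq]
    exact hQ.setLAverage_le hx f
  have hhölder : V ^ (1 / p.toReal - 1) * I ≤ eLpNorm f p volume := by
    calc V ^ (1 / p.toReal - 1) * I
        ≤ V ^ (1 / p.toReal - 1) * (eLpNorm f p volume * V ^ (1 - 1 / p.toReal)) := by
          gcongr
          exact setLIntegral_le_eLpNorm_mul_rpow hf hp Q
      _ = eLpNorm f p volume := by
          rw [mul_left_comm, ← ENNReal.rpow_add _ _ hV0 hVtop]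
          simp
  calc V ^ (θ / p.toReal - 1) * I
      = (V ^ (-1 : ℝ) * I) ^ (1 - θ) * (V ^ (1 / p.toReal - 1) * I) ^ θ := by
        rw [ENNReal.mul_rpow_of_nonneg _ _ hθ1', ENNReal.mul_rpow_of_nonneg _ _ hθ0,
          mul_mul_mul_comm, ← ENNReal.rpow_mul, ← ENNReal.rpow_mul,
          ← ENNReal.rpow_add _ _ hV0 hVtop, ← ENNReal.rpow_add_of_nonneg _ _ hθ1' hθ0,
          sub_add_cancel, ENNReal.rpow_one]
        ring_nf
    _ ≤ (ballCubeRatio n * maximalFunction volume f x) ^ (1 - θ) * eLpNorm f p volume ^ θ := by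
        gcongr

end Hedberg

section Hemicontinuity

open Filter Topology

variable {X : Type*} [TopologicalSpace X]

theorem lowerHemicontinuous_closure {Y : Type*} [TopologicalSpace Y] {f : X → Set Y}
    (hf : LowerHemicontinuous f) : LowerHemicontinuous fun x => closure (f x) := by
  refine fun x => lowerHemicontinuousAt_iff.2 fun u hu h => ?_
  simp only [closure_inter_open_nonempty_iff hu] at h ⊢
  exact lowerHemicontinuousAt_iff.1 (hf x) u hu h

theorem lowerHemicontinuous_convexHull {E : Type*} [AddCommGroup E] [Module ℝ E]
    [TopologicalSpace E] [ContinuousAdd E] [ContinuousConstSMul ℝ E] {f : X → Set E}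
    (hf : LowerHemicontinuous f) : LowerHemicontinuous fun x => convexHull ℝ (f x) := by
  intro x
  have hconvex : Convex ℝ
      {v | ∀ u, IsOpen u → v ∈ u → ∀ᶠ y in 𝓝 x, (convexHull ℝ (f y) ∩ u).Nonempty} := by
    intro v hv w hw a b ha hb hab u hu hvw
    have hcont : Continuous fun z : E × E => a • z.1 + b • z.2 := by fun_prop
    obtain ⟨V, W, hV, hW, hvV, hwW, hVW⟩ :=
      isOpen_prod_iff.1 (hu.preimage hcont) v w hvw
    filter_upwards [hv V hV hvV, hw W hW hwW] with y hvy hwy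
    obtain ⟨v', hv', hv'V⟩ := hvy
    obtain ⟨w', hw', hw'W⟩ := hwy
    exact ⟨a • v' + b • w', convex_convexHull ℝ _ hv' hw' ha hb hab, hVW (mk_mem_prod hv'V hw'W)⟩
  refine lowerHemicontinuousAt_iff.2 fun u hu ⟨v, hv, hvu⟩ => convexHull_min ?_ hconvex hv u hu hvu
  intro w hw u' hu' hwu'
  filter_upwards [lowerHemicontinuousAt_iff.1 (hf x) u' hu' ⟨w, hw, hwu'⟩] with y hy
  exact hy.mono (inter_subset_inter_left _ (subset_convexHull ℝ _))

end Hemicontinuity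

section SetNorm

variable {n d : ℕ} {K : Set (EuclideanSpace ℝ (Fin d))} {v : EuclideanSpace ℝ (Fin d)}

theorem setNorm_le_iff {B : ℝ≥0∞} : setNorm K ≤ B ↔ ∀ v ∈ K, ‖v‖ₑ ≤ B := iSup₂_le_iff

theorem enorm_le_setNorm (hv : v ∈ K) : ‖v‖ₑ ≤ setNorm K := setNorm_le_iff.1 le_rfl v hv

theorem lt_setNorm_iff {t : ℝ≥0∞} : t < setNorm K ↔ (K ∩ {v | t < ‖v‖ₑ}).Nonempty := by
  simp only [setNorm, lt_iSup_iff, exists_prop]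
  rfl

theorem setNorm_lt_top_iff : setNorm K < ∞ ↔ Bornology.IsBounded K := by
  rw [isBounded_iff_forall_norm_le]
  constructor
  · intro h
    refine ⟨(setNorm K).toReal, fun v hv => ?_⟩
    rw [← toReal_enorm]
    exact ENNReal.toReal_mono h.ne (enorm_le_setNorm hv)
  · rintro ⟨C, hC⟩
    refine (setNorm_le_iff.2 fun v hv => ?_).trans_lt (ENNReal.ofReal_lt_top (r := C))
    rw [← ofReal_norm]
    exact ENNReal.ofReal_le_ofReal (hC v hv)

theorem setNorm_smul (c : ℝ) (K : Set (EuclideanSpace ℝ (Fin d))) :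
    setNorm (c • K) = ‖c‖ₑ * setNorm K := by
  simp only [setNorm, ← image_smul, iSup_image, enorm_smul, ENNReal.mul_iSup]

theorem setNorm_closure_convexHull (S : Set (EuclideanSpace ℝ (Fin d))) :
    setNorm (closure (convexHull ℝ S)) = setNorm S := by
  refine le_antisymm (setNorm_le_iff.2 fun v hv => ?_) (setNorm_le_iff.2 fun v hv =>
    enorm_le_setNorm (subset_closure (subset_convexHull ℝ S hv)))
  have hball : closure (convexHull ℝ S) ⊆ Metric.closedEBall 0 (setNorm S) :=
    closure_minimal (convexHull_min (fun w hw => by simpa using enorm_le_setNorm hw)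
      (convex_closedEBall _ _)) Metric.isClosed_closedEBall
  simpa using hball hv

theorem IsKbcs.zero_mem (h : IsKbcs K) : 0 ∈ K := by
  obtain ⟨v, hv⟩ := h.nonempty
  have hneg : -v ∈ K := by rwa [← mem_neg, h.symmetric]
  simpa using h.convex.midpoint_mem hv hneg

theorem SetMeasurable.aemeasurable_setNorm
    {F : EuclideanSpace ℝ (Fin n) → Set (EuclideanSpace ℝ (Fin d))} (hF : SetMeasurable F) :
    AEMeasurable (fun x => setNorm (F x)) volume := by
  refine NullMeasurable.aemeasurable
    (measurable_of_Ioi (δ := NullMeasurableSpace _ volume) fun t => ?_)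
  have hmeas : NullMeasurableSet {x | t < setNorm (F x)} volume := by
    simp only [lt_setNorm_iff]
    exact hF _ (isOpen_lt continuous_const continuous_enorm)
  exact hmeas

theorem MemLK.locallyIntegrablyBounded {p : ℝ≥0∞} (hp : 1 ≤ p)
    {F : EuclideanSpace ℝ (Fin n) → Set (EuclideanSpace ℝ (Fin d))} (hF : MemLK p F) :
    LocallyIntegrablyBounded F := by
  have hmem : MemLp (fun x => (setNorm (F x)).toReal) p volume := by
    refine ⟨hF.measurable.aemeasurable_setNorm.ennreal_toReal.aestronglyMeasurable, ?_⟩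
    refine (eLpNorm_mono_enorm fun x => ?_).trans_lt hF.norm_lt_top
    rw [enorm_eq_self, Real.enorm_of_nonneg ENNReal.toReal_nonneg]
    exact ENNReal.ofReal_toReal_le
  refine ⟨hF.measurable, fun x => (setNorm (F x)).toReal + 1, fun x => by positivity,
    (hmem.locallyIntegrable hp).add (locallyIntegrable_const 1), ?_⟩
  filter_upwards [hF.values] with x hx v hv
  rw [mem_ball_zero_iff, ← toReal_enorm]
  exact (ENNReal.toReal_mono (setNorm_lt_top_iff.2 hx.isBounded).ne
    (enorm_le_setNorm hv)).trans_lt (lt_add_one _)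

end SetNorm

section AumannIntegral

variable {n d : ℕ} {F : EuclideanSpace ℝ (Fin n) → Set (EuclideanSpace ℝ (Fin d))}
  {Q Q' : Set (EuclideanSpace ℝ (Fin n))} {v : EuclideanSpace ℝ (Fin d)}

theorem setNorm_aumannIntegral_le (Q : Set (EuclideanSpace ℝ (Fin n)))
    (F : EuclideanSpace ℝ (Fin n) → Set (EuclideanSpace ℝ (Fin d))) :
    setNorm (aumannIntegral Q F) ≤ ∫⁻ x in Q, setNorm (F x) := by
  rw [setNorm_le_iff]
  rintro _ ⟨f, -, hfF, rfl⟩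
  refine (enorm_integral_le_lintegral_enorm _).trans (lintegral_mono_ae ?_)
  filter_upwards [hfF] with x hx using enorm_le_setNorm hx

theorem zero_mem_aumannIntegral (hF : ∀ᵐ x, IsKbcs (F x)) : 0 ∈ aumannIntegral Q F := by
  refine ⟨fun _ => 0, integrableOn_zero, ae_restrict_of_ae ?_, by simp⟩
  filter_upwards [hF] with x hx using hx.zero_mem

theorem smul_mem_aumannIntegral (hF : ∀ᵐ x, IsKbcs (F x)) (hv : v ∈ aumannIntegral Q F) {t : ℝ}
    (ht : t ∈ Icc 0 1) : t • v ∈ aumannIntegral Q F := by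
  obtain ⟨f, hf, hfF, rfl⟩ := hv
  refine ⟨fun x => t • f x, hf.smul t, ?_, integral_smul _ _⟩
  filter_upwards [hfF, ae_restrict_of_ae hF] with x hx hK
  exact hK.convex.smul_mem_of_zero_mem hK.zero_mem hx ht

theorem neg_mem_aumannIntegral (hF : ∀ᵐ x, IsKbcs (F x)) (hv : v ∈ aumannIntegral Q F) :
    -v ∈ aumannIntegral Q F := by
  obtain ⟨f, hf, hfF, rfl⟩ := hv
  refine ⟨fun x => -f x, hf.neg, ?_, integral_neg _⟩
  filter_upwards [hfF, ae_restrict_of_ae hF] with x hx hK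
  rwa [← mem_neg, hK.symmetric]

-- Selections on `Q` extend by zero to selections on `Q'`.
theorem aumannIntegral_mono (hF : ∀ᵐ x, IsKbcs (F x)) (hQ : MeasurableSet Q) (h : Q ⊆ Q') :
    aumannIntegral Q F ⊆ aumannIntegral Q' F := by
  rintro _ ⟨f, hf, hfF, rfl⟩
  refine ⟨Q.indicator f, ((integrable_indicator_iff hQ).2 hf).integrableOn,
    ae_restrict_of_ae ?_, ?_⟩
  · filter_upwards [(ae_restrict_iff' hQ).1 hfF, hF] with x hx hK
    by_cases hxQ : x ∈ Q
    · simpa only [indicator_of_mem hxQ] using hx hxQ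
    · simpa only [indicator_of_notMem hxQ] using hK.zero_mem
  · rw [setIntegral_indicator hQ, inter_eq_self_of_subset_right h]

end AumannIntegral

section FractionalMaximal

open Filter Topology

variable {n d : ℕ} {F : EuclideanSpace ℝ (Fin n) → Set (EuclideanSpace ℝ (Fin d))} {α : ℝ}
  {Q Q' : Set (EuclideanSpace ℝ (Fin n))} {x y : EuclideanSpace ℝ (Fin n)}
  {v : EuclideanSpace ℝ (Fin d)}

theorem fractionalAverage_of_mem (hx : x ∈ Q) :
    fractionalAverage Q α F x = (1 / volume.real Q ^ (1 - α)) • aumannIntegral Q F := by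
  rw [fractionalAverage, indicator_of_mem hx, one_smul]

theorem fractionalAverage_of_notMem (hF : ∀ᵐ x, IsKbcs (F x)) (hx : x ∉ Q) :
    fractionalAverage Q α F x = 0 := by
  rw [fractionalAverage, indicator_of_notMem hx]
  exact zero_smul_set ⟨_, smul_mem_smul_set (zero_mem_aumannIntegral hF)⟩

theorem zero_mem_fractionalAverage (hF : ∀ᵐ x, IsKbcs (F x)) : 0 ∈ fractionalAverage Q α F x :=
  zero_mem_smul_set (zero_mem_smul_set (zero_mem_aumannIntegral hF))

theorem neg_mem_fractionalAverage (hF : ∀ᵐ x, IsKbcs (F x)) (hv : v ∈ fractionalAverage Q α F x) :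
    -v ∈ fractionalAverage Q α F x := by
  obtain ⟨_, ⟨w, hw, rfl⟩, rfl⟩ := hv
  exact ⟨_, smul_mem_smul_set (neg_mem_aumannIntegral hF hw), by simp⟩

theorem smul_mem_fractionalAverage_of_subset (hF : ∀ᵐ x, IsKbcs (F x)) (hQ : IsCube Q)
    (hQ' : IsCube Q') (hsub : Q ⊆ Q') (hx : x ∈ Q) (hy : y ∈ Q')
    (hv : v ∈ fractionalAverage Q α F x) {t : ℝ} (ht0 : 0 ≤ t)
    (ht : t * (volume.real Q' / volume.real Q) ^ (1 - α) ≤ 1) :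
    t • v ∈ fractionalAverage Q' α F y := by
  have hpos := hQ.volume_real_pos
  have hpos' := hQ'.volume_real_pos
  rw [fractionalAverage_of_mem hx] at hv
  obtain ⟨w, hw, rfl⟩ := hv
  rw [fractionalAverage_of_mem hy]
  refine ⟨(t * (volume.real Q' / volume.real Q) ^ (1 - α)) • w, aumannIntegral_mono hF
    hQ.measurableSet hsub (smul_mem_aumannIntegral hF hw ⟨by positivity, ht⟩), ?_⟩
  simp only [smul_smul, Real.div_rpow hpos'.le hpos.le]
  congr 1
  field_simp

theorem lowerHemicontinuous_iUnion_fractionalAverage (hF : ∀ᵐ x, IsKbcs (F x)) :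
    LowerHemicontinuous fun x => ⋃ (Q) (_ : IsCube Q), fractionalAverage Q α F x := by
  refine fun x => lowerHemicontinuousAt_iff.2 fun u hu ⟨v, hv, hvu⟩ => ?_
  obtain ⟨Q, hQ, hv⟩ := mem_iUnion₂.1 hv
  by_cases hx : x ∈ Q
  · have hpos := hQ.volume_real_pos
    obtain ⟨t, htu, ht0, ht1⟩ : ∃ t : ℝ, t • v ∈ u ∧ 0 ≤ t ∧ t < 1 := by
      have hlim : Tendsto (fun t : ℝ => t • v) (𝓝[<] 1) (𝓝 v) := by
        have : Continuous fun t : ℝ => t • v := by fun_prop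
        simpa using (this.tendsto 1).mono_left nhdsWithin_le_nhds
      exact ((hlim.eventually (hu.mem_nhds hvu)).and (Ico_mem_nhdsLT one_pos)).exists
    have hratio : ∀ᶠ s in 𝓝 (volume.real Q), t * (s / volume.real Q) ^ (1 - α) ≤ 1 := by
      have hcont : ContinuousAt (fun s => t * (s / volume.real Q) ^ (1 - α)) (volume.real Q) :=
        continuousAt_const.mul (ContinuousAt.rpow_const (by fun_prop) (.inl (by simp [hpos.ne'])))
      exact (hcont.eventually (gt_mem_nhds (by simpa [hpos.ne'] using ht1))).mono fun _ => le_of_lt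
    obtain ⟨Q', hQ', hnhds, hle⟩ := hQ.exists_mem_nhdsSet hratio
    filter_upwards [mem_nhdsSet_iff_forall.1 hnhds x hx] with y hy
    exact ⟨t • v, mem_biUnion hQ' (smul_mem_fractionalAverage_of_subset hF hQ hQ'
      (subset_of_mem_nhdsSet hnhds) hx hy hv ht0 hle), htu⟩
  · rw [fractionalAverage_of_notMem hF hx, Set.mem_zero] at hv
    exact .of_forall fun y => ⟨v, mem_biUnion hQ (hv ▸ zero_mem_fractionalAverage hF), hvu⟩

theorem lowerHemicontinuous_fractionalMaximal (hF : ∀ᵐ x, IsKbcs (F x)) :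
    LowerHemicontinuous (fractionalMaximal α F) :=
  lowerHemicontinuous_closure
    (lowerHemicontinuous_convexHull (lowerHemicontinuous_iUnion_fractionalAverage hF))

theorem setMeasurable_fractionalMaximal (hF : ∀ᵐ x, IsKbcs (F x)) :
    SetMeasurable (fractionalMaximal α F) := fun U hU =>
  (lowerHemicontinuous_iff_isOpen_inter_nonempty.1
    (lowerHemicontinuous_fractionalMaximal hF) U hU).nullMeasurableSet

theorem isKbcs_fractionalMaximal (hF : ∀ᵐ x, IsKbcs (F x))
    (hx : setNorm (fractionalMaximal α F x) < ∞) : IsKbcs (fractionalMaximal α F x) where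
  nonempty := ⟨0, subset_closure (subset_convexHull ℝ _ (mem_biUnion
    (isCube_cube 0 one_pos) (zero_mem_fractionalAverage hF)))⟩
  isClosed := isClosed_closure
  isBounded := setNorm_lt_top_iff.1 hx
  convex := (convex_convexHull ℝ _).closure
  symmetric := by
    rw [fractionalMaximal, neg_closure, ← convexHull_neg]
    congr 2
    ext v
    simp only [Set.mem_neg, mem_iUnion]
    refine exists₂_congr fun Q _ => ⟨fun h => ?_, neg_mem_fractionalAverage hF⟩
    simpa using neg_mem_fractionalAverage hF h

theorem setNorm_fractionalAverage_of_mem_le (hQ : IsCube Q) (hx : x ∈ Q) :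
    setNorm (fractionalAverage Q α F x) ≤ volume Q ^ (α - 1) * ∫⁻ y in Q, setNorm (F y) := by
  have hpos := hQ.volume_real_pos
  have henorm : ‖1 / volume.real Q ^ (1 - α)‖ₑ = volume Q ^ (α - 1) := by
    rw [one_div, ← Real.rpow_neg hpos.le, neg_sub, Real.enorm_of_nonneg (by positivity),
      ← ENNReal.ofReal_rpow_of_pos hpos, ofReal_measureReal hQ.volume_ne_top]
  rw [fractionalAverage_of_mem hx, setNorm_smul, henorm]
  gcongr
  exact setNorm_aumannIntegral_le Q F

theorem setNorm_fractionalMaximal_le (hF : ∀ᵐ x, IsKbcs (F x)) {B : ℝ≥0∞}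
    (h : ∀ Q, IsCube Q → x ∈ Q → volume Q ^ (α - 1) * ∫⁻ y in Q, setNorm (F y) ≤ B) :
    setNorm (fractionalMaximal α F x) ≤ B := by
  rw [fractionalMaximal, setNorm_closure_convexHull, setNorm_le_iff]
  intro v hv
  obtain ⟨Q, hQ, hv⟩ := mem_iUnion₂.1 hv
  by_cases hx : x ∈ Q
  · exact (enorm_le_setNorm hv).trans
      ((setNorm_fractionalAverage_of_mem_le hQ hx).trans (h Q hQ hx))
  · rw [fractionalAverage_of_notMem hF hx, Set.mem_zero] at hv
    simp [hv]

theorem setNorm_fractionalMaximal_le_mul_rpow (hF : ∀ᵐ x, IsKbcs (F x)) (hFm : SetMeasurable F)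
    {p : ℝ≥0∞} (hp : 1 ≤ p) {θ : ℝ} (hθ0 : 0 ≤ θ) (hθ1 : θ ≤ 1) (hα : α = θ / p.toReal)
    (x : EuclideanSpace ℝ (Fin n)) :
    setNorm (fractionalMaximal α F x) ≤
      (ballCubeRatio n * maximalFunction volume (fun y => setNorm (F y)) x) ^ (1 - θ) *
        normLK p F ^ θ :=
  setNorm_fractionalMaximal_le hF fun _ hQ hx =>
    hα ▸ hQ.rpow_mul_setLIntegral_le hx hFm.aemeasurable_setNorm hp hθ0 hθ1

end FractionalMaximal

section NormEstimates

variable {n d : ℕ} {F : EuclideanSpace ℝ (Fin n) → Set (EuclideanSpace ℝ (Fin d))}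

theorem exists_eLpNorm_maximalFunction_le {E : Type*} [NormedAddCommGroup E] [NormedSpace ℝ E]
    [FiniteDimensional ℝ E] [MeasurableSpace E] [BorelSpace E] (μ : Measure E)
    [μ.IsAddHaarMeasure] {p : ℝ≥0∞} (hp : 1 < p) (hp_top : p ≠ ∞) :
    ∃ C : ℝ≥0, ∀ f : E → ℝ≥0∞, AEMeasurable f μ →
      eLpNorm (maximalFunction μ f) p μ ≤ C * eLpNorm f p μ := by
  have hp1 : 1 < p.toReal := by simpa using ENNReal.toReal_strict_mono hp_top hp
  have hp0 : p ≠ 0 := (one_pos.trans hp).ne'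
  obtain ⟨C, hC, hM⟩ := exists_lintegral_maximalFunction_rpow_le μ hp1
  have hpos : 0 ≤ 1 / p.toReal := by positivity
  lift C ^ (1 / p.toReal) to ℝ≥0 using ENNReal.rpow_ne_top_of_nonneg hpos hC with C' hC'
  refine ⟨C', fun f hf => ?_⟩
  simp only [eLpNorm_eq_lintegral_rpow_enorm_toReal hp0 hp_top, enorm_eq_self]
  rw [hC', ← ENNReal.mul_rpow_of_nonneg _ _ hpos]
  gcongr
  exact hM f hf

theorem normLK_top_fractionalMaximal_le {p : ℝ≥0∞} (hp : 1 ≤ p) (hF : MemLK p F) :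
    normLK ∞ (fractionalMaximal (1 / p.toReal) F) ≤ normLK p F := by
  rw [normLK, eLpNorm_exponent_top]
  refine essSup_le_of_ae_le _ (.of_forall fun x => ?_)
  simpa using setNorm_fractionalMaximal_le_mul_rpow hF.values hF.measurable hp zero_le_one le_rfl
    rfl x

theorem normLK_fractionalMaximal_le_mul_rpow {p : ℝ≥0∞} (hp : 1 ≤ p) (hF : MemLK p F) {θ : ℝ}
    (hθ0 : 0 ≤ θ) (hθ1 : θ < 1) (q : ℝ≥0∞) :
    normLK q (fractionalMaximal (θ / p.toReal) F) ≤
      (ballCubeRatio n * eLpNorm (maximalFunction volume fun y => setNorm (F y))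
        (q * ENNReal.ofReal (1 - θ)) volume) ^ (1 - θ) * normLK p F ^ θ := by
  have hs : 0 < 1 - θ := sub_pos.2 hθ1
  have hpt := setNorm_fractionalMaximal_le_mul_rpow hF.values hF.measurable hp hθ0 hθ1.le rfl
  set M := maximalFunction volume fun y => setNorm (F y)
  lift ballCubeRatio n ^ (1 - θ) * normLK p F ^ θ to ℝ≥0 using
    ENNReal.mul_ne_top (ENNReal.rpow_ne_top_of_nonneg hs.le ballCubeRatio_ne_top)
      (ENNReal.rpow_ne_top_of_nonneg hθ0 hF.norm_lt_top.ne) with A hA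
  calc normLK q (fractionalMaximal (θ / p.toReal) F)
      ≤ A • eLpNorm (fun x => ‖M x‖ₑ ^ (1 - θ)) q volume := by
        refine eLpNorm_le_nnreal_smul_eLpNorm_of_ae_le_mul' (.of_forall fun x => ?_) q
        refine (hpt x).trans_eq ?_
        rw [hA, ENNReal.mul_rpow_of_nonneg _ _ hs.le, mul_right_comm]
        rfl
    _ = (ballCubeRatio n * eLpNorm M (q * ENNReal.ofReal (1 - θ)) volume) ^ (1 - θ) *
          normLK p F ^ θ := by
        rw [eLpNorm_enorm_rpow _ hs, ENNReal.smul_def, smul_eq_mul, hA,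
          ENNReal.mul_rpow_of_nonneg _ _ hs.le, mul_right_comm]

theorem exists_normLK_fractionalMaximal_le (n d : ℕ) {p q : ℝ≥0∞} (hp : 1 < p) (hpq : p ≤ q) :
    ∃ C : ℝ≥0, ∀ F : EuclideanSpace ℝ (Fin n) → Set (EuclideanSpace ℝ (Fin d)), MemLK p F →
      normLK q (fractionalMaximal (1 / p.toReal - 1 / q.toReal) F) ≤ C * normLK p F := by
  rcases eq_or_ne q ∞ with rfl | hq
  · exact ⟨1, fun F hF => by simpa using normLK_top_fractionalMaximal_le hp.le hF⟩
  have hp_top : p ≠ ∞ := ne_top_of_le_ne_top hq hpq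
  have hp_pos : 0 < p := one_pos.trans hp
  have hp_pos' : 0 < p.toReal := ENNReal.toReal_pos hp_pos.ne' hp_top
  have hpq' : p.toReal ≤ q.toReal := ENNReal.toReal_mono hq hpq
  have hq_pos : 0 < q.toReal := hp_pos'.trans_le hpq'
  obtain ⟨θ, hθ⟩ : ∃ θ, θ = 1 - p.toReal / q.toReal := ⟨_, rfl⟩
  have hs : 0 < 1 - θ := by rw [hθ, sub_sub_cancel]; positivity
  have hθ0 : 0 ≤ θ := by rw [hθ]; exact sub_nonneg.2 (div_le_one_of_le₀ hpq' hq_pos.le)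
  have hα : 1 / p.toReal - 1 / q.toReal = θ / p.toReal := by rw [hθ]; field_simp
  have hexp : q * ENNReal.ofReal (1 - θ) = p := by
    rw [hθ, sub_sub_cancel, ENNReal.ofReal_div_of_pos hq_pos, ENNReal.ofReal_toReal hp_top,
      ENNReal.ofReal_toReal hq, ENNReal.mul_div_cancel (hp_pos.trans_le hpq).ne' hq]
  obtain ⟨C, hC⟩ := exists_eLpNorm_maximalFunction_le
    (volume : Measure (EuclideanSpace ℝ (Fin n))) hp hp_top
  lift (ballCubeRatio n * C) ^ (1 - θ) to ℝ≥0 using ENNReal.rpow_ne_top_of_nonneg hs.le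
    (ENNReal.mul_ne_top ballCubeRatio_ne_top ENNReal.coe_ne_top) with C' hC'
  refine ⟨C', fun F hF => ?_⟩
  calc normLK q (fractionalMaximal (1 / p.toReal - 1 / q.toReal) F)
      ≤ (ballCubeRatio n * eLpNorm (maximalFunction volume fun y => setNorm (F y)) p volume) ^
          (1 - θ) * normLK p F ^ θ := by
        have := normLK_fractionalMaximal_le_mul_rpow hp.le hF hθ0 (sub_pos.1 hs) q
        rwa [hexp, ← hα] at this
    _ ≤ (ballCubeRatio n * (C * normLK p F)) ^ (1 - θ) * normLK p F ^ θ := by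
        gcongr
        exact hC _ hF.measurable.aemeasurable_setNorm
    _ = C' * normLK p F := by
        rw [hC', ← mul_assoc, ENNReal.mul_rpow_of_nonneg _ _ hs.le, mul_assoc,
          ← ENNReal.rpow_add_of_nonneg _ _ hs.le hθ0, sub_add_cancel, ENNReal.rpow_one]

theorem mul_measure_lt_rpow_le_of_le_mul_rpow {X : Type*} [MeasurableSpace X] {μ : Measure X}
    {g h : X → ℝ≥0∞} {A B : ℝ≥0∞} (hA : A ≠ ∞) {s : ℝ} (hs : 0 < s)
    (hgh : ∀ x, g x ≤ A * h x ^ s) (hh : ∀ t, t * μ {x | t < h x} ≤ B) (t : ℝ≥0∞) :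
    t * μ {x | t < g x} ^ s ≤ A * B ^ s := by
  rcases eq_or_ne A 0 with rfl | hA0
  · have hempty : {x | t < g x} = ∅ :=
      eq_empty_of_forall_notMem fun x (hx : t < g x) => by simpa using hx.trans_le (hgh x)
    simp [hempty, hs]
  obtain ⟨l, hl⟩ : ∃ l : ℝ≥0∞, A * l ^ s = t := by
    refine ⟨(t / A) ^ s⁻¹, ?_⟩
    rw [ENNReal.rpow_inv_rpow hs.ne', ENNReal.mul_div_cancel hA0 hA]
  have hsub : {x | t < g x} ⊆ {x | l < h x} := by
    intro x (hx : t < g x)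
    have hx' : A * l ^ s < A * h x ^ s := hl ▸ hx.trans_le (hgh x)
    exact (ENNReal.rpow_lt_rpow_iff hs).1 (lt_of_mul_lt_mul_left' hx')
  calc t * μ {x | t < g x} ^ s
      ≤ A * l ^ s * μ {x | l < h x} ^ s := by rw [hl]; gcongr
    _ = A * (l * μ {x | l < h x}) ^ s := by
        rw [ENNReal.mul_rpow_of_nonneg _ _ hs.le, mul_assoc]
    _ ≤ A * B ^ s := by
        gcongr
        exact hh l

theorem normWeakLK_fractionalMaximal_le {α : ℝ} (hα0 : 0 ≤ α) (hα1 : α < 1) (hF : MemLK 1 F) :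
    normWeakLK (1 / (1 - α)) (fractionalMaximal α F) ≤
      (ballCubeRatio n * 4 ^ n) ^ (1 - α) * normLK 1 F := by
  have hs : 0 < 1 - α := sub_pos.2 hα1
  have hpt := setNorm_fractionalMaximal_le_mul_rpow hF.values hF.measurable le_rfl hα0 hα1.le
    (by simp : α = α / ENNReal.toReal 1)
  have hweak (t : ℝ≥0∞) :
      t * volume {x | t < maximalFunction volume (fun y => setNorm (F y)) x} ≤
        4 ^ n * normLK 1 F := by
    simpa [normLK, eLpNorm_one_eq_lintegral_enorm] using
      mul_measure_lt_maximalFunction_le (μ := volume) (fun y => setNorm (F y)) t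
  refine iSup₂_le fun t _ => ?_
  rw [one_div_one_div]
  calc _ ≤ ballCubeRatio n ^ (1 - α) * normLK 1 F ^ α * (4 ^ n * normLK 1 F) ^ (1 - α) := by
        refine mul_measure_lt_rpow_le_of_le_mul_rpow
          (ENNReal.mul_ne_top (ENNReal.rpow_ne_top_of_nonneg hs.le ballCubeRatio_ne_top)
            (ENNReal.rpow_ne_top_of_nonneg hα0 hF.norm_lt_top.ne)) hs (fun x => ?_) hweak t
        refine (hpt x).trans_eq ?_
        rw [ENNReal.mul_rpow_of_nonneg _ _ hs.le, mul_right_comm]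
    _ = (ballCubeRatio n * 4 ^ n) ^ (1 - α) * (normLK 1 F ^ α * normLK 1 F ^ (1 - α)) := by
        simp only [ENNReal.mul_rpow_of_nonneg _ _ hs.le]
        ring
    _ = (ballCubeRatio n * 4 ^ n) ^ (1 - α) * normLK 1 F := by
        rw [← ENNReal.rpow_add_of_nonneg _ _ hα0 hs.le, add_sub_cancel, ENNReal.rpow_one]

theorem ae_setNorm_lt_top_of_normLK_lt_top {q : ℝ≥0∞} (hq : q ≠ 0) (hF : SetMeasurable F)
    (h : normLK q F < ∞) : ∀ᵐ x, setNorm (F x) < ∞ := by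
  rcases eq_or_ne q ∞ with rfl | hq'
  · rw [normLK, eLpNorm_exponent_top] at h
    filter_upwards [ae_le_eLpNormEssSup (f := fun x => setNorm (F x)) (μ := volume)] with x hx
      using hx.trans_lt h
  · have hq0 : 0 < q.toReal := ENNReal.toReal_pos hq hq'
    have hfin := lintegral_rpow_enorm_lt_top_of_eLpNorm_lt_top hq hq' h
    filter_upwards [ae_lt_top' (hF.aemeasurable_setNorm.enorm.pow_const _) hfin.ne] with x hx
    exact (ENNReal.rpow_lt_top_iff_of_pos hq0).1 hx

theorem ae_setNorm_lt_top_of_normWeakLK_lt_top {r : ℝ} (hr : 0 < r) (h : normWeakLK r F < ∞) :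
    ∀ᵐ x, setNorm (F x) < ∞ := by
  rw [ae_iff]
  by_contra hne
  have hc : volume {x | ¬setNorm (F x) < ∞} ^ (1 / r) ≠ 0 := fun h0 =>
    hne ((ENNReal.rpow_eq_zero_iff_of_pos (by positivity)).1 h0)
  obtain ⟨k, hk⟩ := ENNReal.exists_nat_mul_gt hc h.ne
  have hk0 : 0 < (k : ℝ≥0) := Nat.cast_pos.2 (Nat.pos_of_ne_zero fun h0 => by simp [h0] at hk)
  refine hk.not_ge ?_
  calc k * volume {x | ¬setNorm (F x) < ∞} ^ (1 / r)
      ≤ (k : ℝ≥0) * volume {x | ((k : ℝ≥0) : ℝ≥0∞) < setNorm (F x)} ^ (1 / r) := by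
        rw [ENNReal.coe_natCast]
        gcongr with x
        intro hx
        rw [not_lt_top_iff.1 hx]
        exact ENNReal.natCast_lt_top k
    _ ≤ normWeakLK r F := le_iSup₂_of_le (k : ℝ≥0) hk0 le_rfl

theorem memLK_fractionalMaximal {α : ℝ} {q : ℝ≥0∞} (hq : q ≠ 0) (hF : ∀ᵐ x, IsKbcs (F x))
    (h : normLK q (fractionalMaximal α F) < ∞) : MemLK q (fractionalMaximal α F) where
  measurable := setMeasurable_fractionalMaximal hF
  values := (ae_setNorm_lt_top_of_normLK_lt_top hq (setMeasurable_fractionalMaximal hF) h).mono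
    fun _ => isKbcs_fractionalMaximal hF
  norm_lt_top := h

theorem memWeakLK_fractionalMaximal {α r : ℝ} (hr : 0 < r) (hF : ∀ᵐ x, IsKbcs (F x))
    (h : normWeakLK r (fractionalMaximal α F) < ∞) : MemWeakLK r (fractionalMaximal α F) where
  measurable := setMeasurable_fractionalMaximal hF
  values := (ae_setNorm_lt_top_of_normWeakLK_lt_top hr h).mono
    fun _ => isKbcs_fractionalMaximal hF
  norm_lt_top := h

end NormEstimates

end ConvexSetValued

theorem theorem3p3_general (n d : ℕ) (α : ℝ) (hα0 : 0 ≤ α) (hα1 : α < 1) :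
    (∀ p q : ℝ≥0∞, 1 < p → p ≤ q → 1 / p - 1 / q = ENNReal.ofReal α →
      ∃ C : ℝ≥0, ∀ F : EuclideanSpace ℝ (Fin n) → Set (EuclideanSpace ℝ (Fin d)),
        MemLK p F →
          LocallyIntegrablyBounded F ∧
          MemLK q (fractionalMaximal α F) ∧
          normLK q (fractionalMaximal α F) ≤ C * normLK p F) ∧
    (∃ C : ℝ≥0, ∀ F : EuclideanSpace ℝ (Fin n) → Set (EuclideanSpace ℝ (Fin d)),
      MemLK 1 F →
        LocallyIntegrablyBounded F ∧
        MemWeakLK (1 / (1 - α)) (fractionalMaximal α F) ∧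
        normWeakLK (1 / (1 - α)) (fractionalMaximal α F) ≤ C * normLK 1 F) := by
  refine ⟨fun p q hp hpq h => ?_, ?_⟩
  · have hα : 1 / p.toReal - 1 / q.toReal = α := by
      have h' := congrArg ENNReal.toReal h
      rw [ENNReal.toReal_ofReal hα0, ENNReal.toReal_sub_of_le
        (ENNReal.div_le_div_left hpq 1) (by simp [(one_pos.trans hp).ne'])] at h'
      simpa using h'
    obtain ⟨C, hC⟩ := hα ▸ exists_normLK_fractionalMaximal_le n d hp hpq
    refine ⟨C, fun F hF => ⟨hF.locallyIntegrablyBounded hp.le, ?_, hC F hF⟩⟩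
    exact memLK_fractionalMaximal (one_pos.trans (hp.trans_le hpq)).ne' hF.values
      ((hC F hF).trans_lt (ENNReal.mul_lt_top ENNReal.coe_lt_top hF.norm_lt_top))
  · have hs : 0 < 1 - α := sub_pos.2 hα1
    lift (ballCubeRatio n * 4 ^ n) ^ (1 - α) to ℝ≥0 using ENNReal.rpow_ne_top_of_nonneg hs.le
      (ENNReal.mul_ne_top ballCubeRatio_ne_top (by finiteness)) with C hC
    refine ⟨C, fun F hF => ?_⟩
    have hbound := hC ▸ normWeakLK_fractionalMaximal_le hα0 hα1 hF
    refine ⟨hF.locallyIntegrablyBounded le_rfl, ?_, hbound⟩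
    exact memWeakLK_fractionalMaximal (by positivity) hF.values
      (hbound.trans_lt (ENNReal.mul_lt_top ENNReal.coe_lt_top hF.norm_lt_top))

theorem theorem3p3 (n d : ℕ) (α : ℝ) (hα0 : 0 < α) (hα1 : α < 1) :
    (∀ p q : ℝ≥0∞, 1 < p → p < q → 1 / p - 1 / q = ENNReal.ofReal α →
      ∃ C : ℝ≥0, ∀ F : EuclideanSpace ℝ (Fin n) → Set (EuclideanSpace ℝ (Fin d)),
        MemLK p F →
          LocallyIntegrablyBounded F ∧
          MemLK q (fractionalMaximal α F) ∧
          normLK q (fractionalMaximal α F) ≤ C * normLK p F) ∧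
    (∃ C : ℝ≥0, ∀ F : EuclideanSpace ℝ (Fin n) → Set (EuclideanSpace ℝ (Fin d)),
      MemLK 1 F →
        LocallyIntegrablyBounded F ∧
        MemWeakLK (1 / (1 - α)) (fractionalMaximal α F) ∧
        normWeakLK (1 / (1 - α)) (fractionalMaximal α F) ≤ C * normLK 1 F) := by
  have h := theorem3p3_general n d α hα0.le hα1
  exact ⟨fun p q hp hpq => h.1 p q hp hpq.le, h.2⟩
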